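/- Let $w=w_0w_1w_2\cdots$ be a Sturmian word, that is, an infinite word over a finite alphabet $A$ having exactly $n+1$ distinct factors of length $n$ for every $n\ge 0$, and let $u$ be a factor of $w$. Two finite words are abelian equivalent if they are permutations of each other. Let $n_1<n_2<\cdots$ be all the positions $n_i$ such that $w_{n_i}\cdots w_{n_i+|u|-1}$ is abelian equivalent to $u$; the abelian returns to $u$ in $w$ are the abelian equivalence classes of the words $w_{n_i}\cdots w_{n_{i+1}-1}$, $i\ge 1$. The factor $u$ is called singular if it is the only factor of $w$ in its abelian equivalence class. Then $u$ has exactly two abelian returns in $w$ if and only if $u$ is singular. Moreover, every singular factor of length at least $2$ has the form $aBa$, where $a$ is a letter and $B$ is a (possibly empty) bispecial factor of $w$, that is, a factor such that $Bx$ and $By$ are factors of $w$ for some letters $x\ne y$, and $x'B$ and $y'B$ are factors of $w$ for some letters $x'\ne y'$. -/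

import Mathlib

/-- The finite word `w i, w (i+1), …, w (i+n-1)` of length `n` read in the infinite word `w`
from position `i`. -/
def factorAt {A : Type*} (w : ℕ → A) (i n : ℕ) : List A :=
  List.ofFn (fun k : Fin n => w (i + k))

/-- The finite word `u` (possibly empty) is a factor of the infinite word `w`. -/
def IsFactor {A : Type*} (w : ℕ → A) (u : List A) : Prop :=
  ∃ i, factorAt w i u.length = u

/-- `w` is Sturmian: for every `n` it has exactly `n + 1` distinct factors of length `n`. -/
def IsSturmian {A : Type*} (w : ℕ → A) : Prop :=
  ∀ n : ℕ, {u : List A | IsFactor w u ∧ u.length = n}.ncard = n + 1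

/-- Abelian equivalence of finite words: they are permutations of each other. -/
def AbelianEquiv {A : Type*} (u v : List A) : Prop := u.Perm v

/-- An abelian equivalent of `u` occurs in `w` at position `i`. -/
def AbelianOccursAt {A : Type*} (w : ℕ → A) (u : List A) (i : ℕ) : Prop :=
  AbelianEquiv (factorAt w i u.length) u

/-- The set of abelian returns to `u` in `w`: the abelian classes of the words
`w i, …, w (j-1)`, where `i < j` are consecutive positions at which words abelian
equivalent to `u` occur. The abelian class of a finite word is represented by its multiset
of letters, which is by definition its class in the quotient of `List A` by permutation. -/
def abelianReturns {A : Type*} (w : ℕ → A) (u : List A) : Set (Multiset A) :=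
  {m | ∃ i j : ℕ, i < j ∧ AbelianOccursAt w u i ∧ AbelianOccursAt w u j ∧
    (∀ k, i < k → k < j → ¬ AbelianOccursAt w u k) ∧
    m = (factorAt w i (j - i) : Multiset A)}

/-- `u` is a singular factor of `w`: the only factor of `w` in its abelian class. -/
def IsSingular {A : Type*} (w : ℕ → A) (u : List A) : Prop :=
  IsFactor w u ∧ ∀ v : List A, IsFactor w v → AbelianEquiv v u → v = u

/-- `u` can be prolonged in `w` by two distinct letters on the right. -/
def IsRightSpecial {A : Type*} (w : ℕ → A) (u : List A) : Prop :=
  ∃ a b : A, a ≠ b ∧ IsFactor w (u ++ [a]) ∧ IsFactor w (u ++ [b])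

/-- `u` can be prolonged in `w` by two distinct letters on the left. -/
def IsLeftSpecial {A : Type*} (w : ℕ → A) (u : List A) : Prop :=
  ∃ a b : A, a ≠ b ∧ IsFactor w (a :: u) ∧ IsFactor w (b :: u)

/-- `u` is a bispecial factor of `w`. -/
def IsBispecial {A : Type*} (w : ℕ → A) (u : List A) : Prop :=
  IsRightSpecial w u ∧ IsLeftSpecial w u

/-! ### Special factors of Sturmian words -/

section Factors

variable {A : Type*} {w : ℕ → A}

/-! The proof turns abelian returns into first returns of an irrational rotation to an interval. A
Sturmian word uses two letters and is balanced (`IsSturmian.balanced`). So, if `S i` counts the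
letter `b` before position `i`, there is a slope `α` such that the deviation `i * α - S i` stays in
an interval `[lo, lo + 1]`. Aperiodicity makes `α` irrational, and advancing by `p` moves the
deviation by `p * α` modulo 1.

For `n > 0`, a window of length `n` contains `⌊n * α⌋` or `⌊n * α⌋ + 1` letters `b`. After
exchanging the letters if necessary, `u` has the larger count, so `u` recurs up to permutation
exactly when the deviation is in the top part of the interval, of length `β = fract (n * α)`.

If `u` is singular, an upward move inside this top part takes more than `n` steps. With `τ` the
least time of a downward move, say by `t`, the only returns are `τ` (move `-t`) and `n + τ` (move `β
- t`); see `IsCutting.two_returns`. Conversely, if there are only two returns, one goes up by `t₁`,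
the other down by `t₂`, and `t₁ + t₂ = β`; hence the upward time is `n` plus the downward one. But
two distinct heavy windows would give an upward move within `n` steps (`IsCutting.not_two_returns`).

For the shape of `u`, extend the right special factor of length `n - 1` by `b`: the result is heavy,
hence equal to `u`. The same holds on the left, so `u` begins and ends with `b` and its middle is
bispecial. -/

theorem length_factorAt (w : ℕ → A) (i n : ℕ) : (factorAt w i n).length = n := by
  simp [factorAt]

theorem factorAt_eq_iff {i j n : ℕ} :
    factorAt w i n = factorAt w j n ↔ ∀ k < n, w (i + k) = w (j + k) := by
  unfold factorAt
  rw [List.ofFn_inj, funext_iff]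
  exact ⟨fun h k hk => h ⟨k, hk⟩, fun h k => h k k.2⟩

theorem factorAt_succ (w : ℕ → A) (i n : ℕ) :
    factorAt w i (n + 1) = factorAt w i n ++ [w (i + n)] := by
  unfold factorAt
  rw [List.ofFn_succ_last]
  simp

theorem factorAt_succ' (w : ℕ → A) (i n : ℕ) :
    factorAt w i (n + 1) = w i :: factorAt w (i + 1) n := by
  unfold factorAt
  rw [List.ofFn_succ]
  simp [Nat.add_assoc, Nat.add_comm 1]

theorem isFactor_factorAt (w : ℕ → A) (i n : ℕ) : IsFactor w (factorAt w i n) :=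
  ⟨i, by rw [length_factorAt]⟩

theorem setOf_isFactor (w : ℕ → A) (n : ℕ) :
    {u : List A | IsFactor w u ∧ u.length = n} = Set.range (fun i => factorAt w i n) := by
  ext u
  constructor
  · rintro ⟨⟨i, hi⟩, rfl⟩
    exact ⟨i, hi⟩
  · rintro ⟨i, rfl⟩
    exact ⟨isFactor_factorAt w i n, length_factorAt w i n⟩

namespace IsSturmian

theorem ncard_range (hw : IsSturmian w) (n : ℕ) :
    (Set.range (fun i => factorAt w i n)).ncard = n + 1 := by
  rw [← setOf_isFactor]
  exact hw n

theorem finite_range (hw : IsSturmian w) (n : ℕ) :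
    (Set.range (fun i => factorAt w i n)).Finite :=
  Set.finite_of_ncard_ne_zero (by rw [hw.ncard_range]; omega)

/-- A Sturmian word is not eventually periodic. -/
theorem not_eventually_periodic (hw : IsSturmian w) {N p : ℕ} (hp : 0 < p)
    (h : ∀ i, N ≤ i → w (i + p) = w i) : False := by
  -- Every suffix of `w` already starts before `N + p`, which leaves at most `N + p` factors of
  -- length `N + p`, one too few.
  have key : ∀ i, ∃ j < N + p, ∀ k, w (i + k) = w (j + k) := by
    intro i
    induction i using Nat.strong_induction_on with
    | _ i ih =>
      by_cases hi : i < N + p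
      · exact ⟨i, hi, fun _ => rfl⟩
      · obtain ⟨j, hj, hk⟩ := ih (i - p) (by omega)
        refine ⟨j, hj, fun k => ?_⟩
        rw [← hk, ← h (i - p + k) (by omega)]
        congr 1
        omega
  have hsub : Set.range (fun i => factorAt w i (N + p)) ⊆
      (fun i => factorAt w i (N + p)) '' (Finset.range (N + p) : Set ℕ) := by
    rintro _ ⟨i, rfl⟩
    obtain ⟨j, hj, hk⟩ := key i
    exact ⟨j, by simpa using hj, factorAt_eq_iff.2 fun k _ => (hk k).symm⟩
  have h1 := Set.ncard_le_ncard hsub ((Finset.finite_toSet _).image _)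
  have h2 := Set.ncard_image_le (f := fun i => factorAt w i (N + p))
    (Finset.finite_toSet (Finset.range (N + p)))
  rw [hw.ncard_range] at h1
  rw [Set.ncard_coe_finset, Finset.card_range] at h2
  omega

/-- Otherwise deleting the last letter would inject `n + 2` factors into `n + 1`. -/
theorem exists_rightSpecial (hw : IsSturmian w) (n : ℕ) :
    ∃ i j, factorAt w i n = factorAt w j n ∧ w (i + n) ≠ w (j + n) := by
  by_contra! hcon
  have h := Set.ncard_le_ncard_of_injOn (s := Set.range (fun i => factorAt w i (n + 1)))
    (t := Set.range (fun i => factorAt w i n)) (fun u => u.dropLast)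
    (by rintro _ ⟨i, rfl⟩; exact ⟨i, by simp [factorAt_succ]⟩)
    (by
      rintro _ ⟨i, rfl⟩ _ ⟨j, rfl⟩ hij
      simp only [factorAt_succ, List.dropLast_concat] at hij
      simp only [factorAt_succ, hij, hcon i j hij])
    (hw.finite_range n)
  rw [hw.ncard_range, hw.ncard_range] at h
  omega

theorem exists_leftSpecial (hw : IsSturmian w) (n : ℕ) :
    ∃ i j, factorAt w (i + 1) n = factorAt w (j + 1) n ∧ w i ≠ w j := by
  by_contra! hcon
  have h := Set.ncard_le_ncard_of_injOn (s := Set.range (fun i => factorAt w i (n + 1)))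
    (t := Set.range (fun i => factorAt w i n)) (fun u => u.tail)
    (by rintro _ ⟨i, rfl⟩; exact ⟨i + 1, by simp [factorAt_succ']⟩)
    (by
      rintro _ ⟨i, rfl⟩ _ ⟨j, rfl⟩ hij
      simp only [factorAt_succ', List.tail_cons] at hij
      simp only [factorAt_succ', hij, hcon i j hij])
    (hw.finite_range n)
  rw [hw.ncard_range, hw.ncard_range] at h
  omega

/-- A Sturmian word has at most one right special factor of each length. -/
theorem rightSpecial_unique (hw : IsSturmian w) {n i i' j j' : ℕ}
    (hi : factorAt w i n = factorAt w i' n) (hi' : w (i + n) ≠ w (i' + n))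
    (hj : factorAt w j n = factorAt w j' n) (hj' : w (j + n) ≠ w (j' + n)) :
    factorAt w i n = factorAt w j n := by
  by_contra hne
  let T := Set.range (fun i => factorAt w i n)
  have hext : ∀ v : List A, ∃ p, v ∈ T → factorAt w p n = v := fun v => by
    by_cases hv : v ∈ T
    · obtain ⟨p, hp⟩ := hv
      exact ⟨p, fun _ => hp⟩
    · exact ⟨0, fun h => absurd h hv⟩
  choose σ hσ using hext
  have hother : ∀ p q, factorAt w p n = factorAt w q n → w (p + n) ≠ w (q + n) →
      ∃ r, factorAt w r n = factorAt w p n ∧ w (r + n) ≠ w (σ (factorAt w p n) + n) := by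
    intro p q hpq hne
    by_cases h : w (p + n) = w (σ (factorAt w p n) + n)
    · exact ⟨q, hpq.symm, fun h' => hne (h.trans h'.symm)⟩
    · exact ⟨p, rfl, h⟩
  obtain ⟨r, hr, hr'⟩ := hother i i' hi hi'
  obtain ⟨s, hs, hs'⟩ := hother j j' hj hj'
  -- One chosen extension per factor gives `n + 1` words; two distinct right special factors each
  -- add another, making `n + 3` factors of length `n + 1`.
  let g : List A → List A := fun v => factorAt w (σ v) (n + 1)
  have hg : Set.InjOn g T := by
    intro v hv v' hv' h
    simp only [g, factorAt_succ, hσ v hv, hσ v' hv'] at h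
    exact (List.append_inj' h rfl).1
  have hgT : (g '' T).ncard = n + 1 := by
    rw [hg.ncard_image]
    exact hw.ncard_range n
  have hfin : (g '' T).Finite := (hw.finite_range n).image g
  have hnot : ∀ p q, factorAt w p n = factorAt w q n →
      w (p + n) ≠ w (σ (factorAt w q n) + n) → factorAt w p (n + 1) ∉ g '' T := by
    rintro p q hpq hne ⟨v, hv, h⟩
    simp only [g, factorAt_succ, hσ v hv] at h
    obtain ⟨h1, h2⟩ := List.append_inj' h rfl
    apply hne
    rw [← hpq, ← h1]
    simpa using h2.symm
  have h1 : factorAt w s (n + 1) ∉ g '' T := hnot s j hs hs'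
  have h2 : factorAt w r (n + 1) ∉ insert (factorAt w s (n + 1)) (g '' T) := by
    rw [Set.mem_insert_iff, not_or]
    refine ⟨fun h => hne ?_, hnot r i hr hr'⟩
    simp only [factorAt_succ] at h
    rw [← hr, ← hs]
    exact (List.append_inj' h rfl).1
  have hsub : insert (factorAt w r (n + 1)) (insert (factorAt w s (n + 1)) (g '' T)) ⊆
      Set.range (fun i => factorAt w i (n + 1)) := by
    rw [Set.insert_subset_iff, Set.insert_subset_iff]
    refine ⟨⟨r, rfl⟩, ⟨s, rfl⟩, ?_⟩
    rintro _ ⟨v, _, rfl⟩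
    exact ⟨σ v, rfl⟩
  have h3 := Set.ncard_le_ncard hsub (hw.finite_range _)
  rw [Set.ncard_insert_of_notMem h2 (hfin.insert _), Set.ncard_insert_of_notMem h1 hfin, hgT,
    hw.ncard_range] at h3
  omega

/-- A Sturmian word is written over exactly two letters. -/
theorem exists_letters (hw : IsSturmian w) : ∃ a b : A, a ≠ b ∧ ∀ i, w i = a ∨ w i = b := by
  have h := hw.ncard_range 1
  obtain ⟨u, v, huv, h⟩ := Set.ncard_eq_two.1 h
  have hmem : ∀ i, [w i] = u ∨ [w i] = v := fun i => by
    have : [w i] ∈ Set.range (fun i => factorAt w i 1) := ⟨i, by simp [factorAt]⟩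
    rw [h] at this
    exact this
  have hu : u ∈ Set.range (fun i => factorAt w i 1) := by rw [h]; simp
  have hv : v ∈ Set.range (fun i => factorAt w i 1) := by rw [h]; simp
  obtain ⟨i, hi⟩ := hu
  obtain ⟨j, hj⟩ := hv
  have hi' : [w i] = u := by rw [← hi]; simp [factorAt]
  have hj' : [w j] = v := by rw [← hj]; simp [factorAt]
  refine ⟨w i, w j, fun h => huv (by rw [← hi', ← hj', h]), fun k => ?_⟩
  rw [← hi', ← hj'] at hmem
  simpa using hmem k

/-- If `c B c` and `d B d` are factors with `B` a palindrome and `c ≠ d`, then `d B` is not the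
right special factor of its length. -/
theorem palindrome_obstruction (hw : IsSturmian w) {N i j : ℕ} (hij : w i ≠ w j)
    (hi : w (i + N + 1) = w i) (hB : ∀ m < N, w (i + 1 + m) = w (j + 1 + m))
    (hpal : ∀ m < N, w (i + 1 + m) = w (i + 1 + (N - 1 - m)))
    (hRS : ∀ p q, factorAt w p (N + 1) = factorAt w q (N + 1) →
      w (p + (N + 1)) ≠ w (q + (N + 1)) → factorAt w p (N + 1) = factorAt w j (N + 1)) :
    False := by
  -- A window starting inside `B` with the letter `d` meets the final `c` at the place that mirrors
  -- this `d` in the palindrome, so it cannot be `d B`.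
  have hwin : ∀ k ≤ N + 1, factorAt w (i + k) (N + 1) ≠ factorAt w j (N + 1) := by
    intro k hk h
    rw [factorAt_eq_iff] at h
    have h0 : w (i + k) = w j := h 0 (by omega)
    rcases Nat.eq_zero_or_pos k with rfl | hk0
    · exact hij h0
    rcases Nat.lt_or_ge N k with hkN | hkN
    · obtain rfl : k = N + 1 := by omega
      exact hij (hi.symm.trans h0)
    have h1 := h (N + 1 - k) (by omega)
    have h2 := hpal (k - 1) (by omega)
    have h3 := hB (N - k) (by omega)
    rw [show i + k + (N + 1 - k) = i + N + 1 by omega, hi] at h1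
    rw [show i + 1 + (k - 1) = i + k by omega,
      show i + 1 + (N - 1 - (k - 1)) = i + 1 + (N - k) by omega, h3] at h2
    rw [show j + (N + 1 - k) = j + 1 + (N - k) by omega, ← h2] at h1
    exact hij (h1.trans h0)
  have hfin := hw.finite_range (N + 1)
  let T := Set.range (fun i => factorAt w i (N + 1)) \ {factorAt w j (N + 1)}
  have hT : T.ncard = N + 1 := by
    rw [Set.ncard_sdiff_singleton_of_mem (Set.mem_range_self j), hw.ncard_range]
    omega
  have hTfin : T.Finite := hfin.subset Set.sdiff_subset
  -- There are `N + 2` windows and only `N + 1` factors other than `d B`. A repeated window has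
  -- forced continuations, so `w` becomes periodic.
  obtain ⟨p, hp, q, hq, hpq, heq⟩ : ∃ p ∈ (Finset.range (N + 2) : Set ℕ),
      ∃ q ∈ (Finset.range (N + 2) : Set ℕ), p ≠ q ∧
      factorAt w (i + p) (N + 1) = factorAt w (i + q) (N + 1) := by
    refine Set.exists_ne_map_eq_of_ncard_lt_of_maps_to (t := T) ?_ ?_ hTfin
    · rw [hT, Set.ncard_coe_finset, Finset.card_range]
      omega
    · intro k hk
      exact ⟨⟨i + k, rfl⟩, hwin k (by simp at hk; omega)⟩
  simp only [Finset.coe_range, Set.mem_Iio] at hp hq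
  wlog hlt : p < q generalizing p q
  · exact this q p hpq.symm heq.symm hq hp (by omega)
  have key : ∀ t, factorAt w (i + p + t) (N + 1) = factorAt w (i + q + t) (N + 1) ∧
      factorAt w (i + p + t) (N + 1) ≠ factorAt w j (N + 1) := by
    intro t
    induction t using Nat.strong_induction_on with
    | _ t ih =>
      constructor
      · rcases Nat.eq_zero_or_pos t with rfl | ht
        · exact heq
        · obtain ⟨h1, h2⟩ := ih (t - 1) (by omega)
          have h3 : w (i + p + (t - 1) + (N + 1)) = w (i + q + (t - 1) + (N + 1)) := by
            by_contra h
            exact h2 (hRS _ _ h1 h)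
          rw [factorAt_eq_iff] at h1 ⊢
          intro k hk
          rcases Nat.lt_or_ge k N with hkN | hkN
          · have := h1 (k + 1) (by omega)
            rwa [show i + p + (t - 1) + (k + 1) = i + p + t + k by omega,
              show i + q + (t - 1) + (k + 1) = i + q + t + k by omega] at this
          · obtain rfl : k = N := by omega
            rwa [show i + p + (t - 1) + (k + 1) = i + p + t + k by omega,
              show i + q + (t - 1) + (k + 1) = i + q + t + k by omega] at h3
      · rcases Nat.lt_or_ge t (q - p) with ht | ht
        · rw [Nat.add_assoc]
          exact hwin _ (by omega)
        · obtain ⟨h1, h2⟩ := ih (t - (q - p)) (by omega)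
          rw [show i + p + t = i + q + (t - (q - p)) by omega, ← h1]
          exact h2
  refine hw.not_eventually_periodic (N := i + p) (p := q - p) (by omega) fun t ht => ?_
  have := factorAt_eq_iff.1 (key (t - (i + p))).1 0 (by omega)
  rw [show t + (q - p) = i + q + (t - (i + p)) + 0 by omega, ← this]
  congr 1
  omega

end IsSturmian

end Factors

/-! ### Letter counts and balance -/

section Balance

variable {A : Type*} {w : ℕ → A}

open Classical in
/-- The number of occurrences of the letter `b` among `w 0, …, w (i - 1)`. -/
noncomputable def prefixCount (w : ℕ → A) (b : A) (i : ℕ) : ℤ :=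
  ∑ k ∈ Finset.range i, if w k = b then 1 else 0

theorem prefixCount_zero (w : ℕ → A) (b : A) : prefixCount w b 0 = 0 := by
  simp [prefixCount]

theorem prefixCount_succ_of_eq {b : A} {i : ℕ} (h : w i = b) :
    prefixCount w b (i + 1) = prefixCount w b i + 1 := by
  rw [prefixCount, Finset.sum_range_succ, if_pos h, prefixCount]

theorem prefixCount_succ_of_ne {b : A} {i : ℕ} (h : w i ≠ b) :
    prefixCount w b (i + 1) = prefixCount w b i := by
  rw [prefixCount, Finset.sum_range_succ, if_neg h, prefixCount, add_zero]

theorem prefixCount_add_prefixCount {a b : A} (hab : a ≠ b) (h : ∀ i, w i = a ∨ w i = b)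
    (i : ℕ) : prefixCount w a i + prefixCount w b i = i := by
  induction i with
  | zero => simp [prefixCount_zero]
  | succ i ih =>
    rcases h i with hi | hi
    · rw [prefixCount_succ_of_eq hi, prefixCount_succ_of_ne (hi.trans_ne hab)]
      push_cast
      linarith
    · rw [prefixCount_succ_of_eq hi, prefixCount_succ_of_ne (hi.trans_ne hab.symm)]
      push_cast
      linarith

open Classical in
theorem count_factorAt (w : ℕ → A) (c : A) (i n : ℕ) :
    ((factorAt w i n).count c : ℤ) = prefixCount w c (i + n) - prefixCount w c i := by
  induction n with
  | zero => simp [factorAt]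
  | succ n ih =>
    rw [factorAt_succ, List.count_append, ← Nat.add_assoc]
    push_cast
    rw [ih]
    by_cases h : w (i + n) = c
    · rw [prefixCount_succ_of_eq h, h, List.count_singleton_self]
      push_cast
      ring
    · rw [prefixCount_succ_of_ne h, List.count_eq_zero_of_not_mem (by simpa using Ne.symm h)]
      simp

theorem factorAt_perm_iff {a b : A} (hab : a ≠ b) (h : ∀ i, w i = a ∨ w i = b)
    {i j n m : ℕ} : (factorAt w i n).Perm (factorAt w j m) ↔
      n = m ∧ prefixCount w b (i + n) - prefixCount w b i =
        prefixCount w b (j + m) - prefixCount w b j := by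
  classical
  constructor
  · intro hp
    refine ⟨by simpa [length_factorAt] using hp.length_eq, ?_⟩
    rw [← count_factorAt, ← count_factorAt, hp.count_eq]
  · rintro ⟨rfl, heq⟩
    rw [List.perm_iff_count]
    intro c
    zify
    rw [count_factorAt, count_factorAt]
    by_cases hcb : c = b
    · rw [hcb, heq]
    by_cases hca : c = a
    · have h1 := prefixCount_add_prefixCount hab h i
      have h2 := prefixCount_add_prefixCount hab h j
      have h3 := prefixCount_add_prefixCount hab h (i + n)
      have h4 := prefixCount_add_prefixCount hab h (j + n)
      rw [hca]
      push_cast at *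
      linarith
    · have hz : ∀ k, prefixCount w c k = 0 := fun k => by
        induction k with
        | zero => exact prefixCount_zero w c
        | succ k ih =>
          rw [prefixCount_succ_of_ne, ih]
          rcases h k with hk | hk
          · rw [hk]; exact Ne.symm hca
          · rw [hk]; exact Ne.symm hcb
      simp [hz]

/-- A Sturmian word is balanced. -/
theorem IsSturmian.balanced (hw : IsSturmian w) {a b : A} (hab : a ≠ b)
    (h : ∀ i, w i = a ∨ w i = b) (n i j : ℕ) :
    prefixCount w b (i + n) - prefixCount w b i ≤
      prefixCount w b (j + n) - prefixCount w b j + 1 := by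
  induction n using Nat.strong_induction_on generalizing i j with
  | _ n ih =>
  set S := prefixCount w b with hS
  by_contra! hcon
  have step : ∀ k, (w k = b ∧ S (k + 1) = S k + 1) ∨ (w k = a ∧ S (k + 1) = S k) := fun k => by
    rcases h k with hk | hk
    · exact Or.inr ⟨hk, prefixCount_succ_of_ne (hk.trans_ne hab)⟩
    · exact Or.inl ⟨hk, prefixCount_succ_of_eq hk⟩
  have hn : 2 ≤ n := by
    by_contra hn
    have := step i
    have := step j
    interval_cases n
    · simp at hcon
    · omega
  obtain ⟨N, rfl⟩ : ∃ N, n = N + 2 := ⟨n - 2, by omega⟩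
  -- In a minimal counterexample the excess is 1 on every proper prefix, so the two windows are `b B
  -- b` and `a B a`.
  have hpre : ∀ m, 0 < m → m < N + 2 → S (i + m) - S i = S (j + m) - S j + 1 := by
    intro m hm0 hm
    have h1 := ih m hm i j
    have h2 := ih (N + 2 - m) (by omega) (i + m) (j + m)
    rw [show i + m + (N + 2 - m) = i + (N + 2) by omega,
      show j + m + (N + 2 - m) = j + (N + 2) by omega] at h2
    omega
  have htot : S (i + (N + 2)) - S i = S (j + (N + 2)) - S j + 2 := by
    have h1 := hpre 1 (by omega) (by omega)
    have h2 := ih (N + 1) (by omega) (i + 1) (j + 1)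
    rw [show i + 1 + (N + 1) = i + (N + 2) by omega,
      show j + 1 + (N + 1) = j + (N + 2) by omega] at h2
    omega
  have hi0 : w i = b ∧ w j = a := by
    have h1 := hpre 1 (by omega) (by omega)
    rcases step i with h2 | h2 <;> rcases step j with h3 | h3
    · omega
    · exact ⟨h2.1, h3.1⟩
    · omega
    · omega
  have hi1 : w (i + N + 1) = b ∧ w (j + N + 1) = a := by
    have h1 := hpre (N + 1) (by omega) (by omega)
    rcases step (i + N + 1) with h2 | h2 <;> rcases step (j + N + 1) with h3 | h3
    · simp only [Nat.add_assoc, Nat.reduceAdd] at *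
      omega
    · exact ⟨h2.1, h3.1⟩
    · simp only [Nat.add_assoc, Nat.reduceAdd] at *
      omega
    · simp only [Nat.add_assoc, Nat.reduceAdd] at *
      omega
  have hB : ∀ m < N, w (i + 1 + m) = w (j + 1 + m) := by
    intro m hm
    have h1 := hpre (m + 1) (by omega) (by omega)
    have h2 := hpre (m + 2) (by omega) (by omega)
    have e1 := step (i + 1 + m)
    have e2 := step (j + 1 + m)
    rw [show i + 1 + m + 1 = i + (m + 2) by omega, show i + 1 + m = i + (m + 1) by omega] at *
    rw [show j + 1 + m + 1 = j + (m + 2) by omega, show j + 1 + m = j + (m + 1) by omega] at *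
    rcases e1 with e1 | e1 <;> rcases e2 with e2 | e2
    · rw [e1.1, e2.1]
    · omega
    · omega
    · rw [e1.1, e2.1]
  -- Minimality, applied to a prefix of `B` preceded by `b` or `a` and to the suffix of equal length
  -- followed by the other letter, equates their counts; hence `B` is a palindrome.
  have hPQ : ∀ m ≤ N, S (i + 1 + m) - S (i + 1) = S (i + 1 + N) - S (i + 1 + (N - m)) := by
    intro m hm
    have h1 := ih (m + 1) (by omega) i (j + 1 + (N - m))
    have h2 := ih (m + 1) (by omega) (i + 1 + (N - m)) j
    have h3 := hpre (m + 1) (by omega) (by omega)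
    have h4 := hpre (N + 1 - m) (by omega) (by omega)
    have h5 := hpre (N + 1) (by omega) (by omega)
    have h6 := hpre 1 (by omega) (by omega)
    have e1 := step (i + N + 1)
    have e2 := step (j + N + 1)
    have e3 := step i
    have e4 := step j
    rw [hi1.1] at e1
    rw [hi1.2] at e2
    rw [hi0.1] at e3
    rw [hi0.2] at e4
    simp only [hab, hab.symm, false_and, true_and, or_false, false_or] at e1 e2 e3 e4
    rw [show j + 1 + (N - m) + (m + 1) = j + N + 1 + 1 by omega,
      show j + 1 + (N - m) = j + (N + 1 - m) by omega] at h1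
    rw [show i + 1 + (N - m) + (m + 1) = i + N + 1 + 1 by omega] at h2
    rw [show i + 1 + (N - m) = i + (N + 1 - m) by omega] at *
    rw [show i + 1 + m = i + (m + 1) by omega, show i + 1 + N = i + N + 1 by omega]
    simp only [← Nat.add_assoc i N 1, ← Nat.add_assoc j N 1] at *
    omega
  have hpal : ∀ m < N, w (i + 1 + m) = w (i + 1 + (N - 1 - m)) := by
    intro m hm
    have h1 := hPQ m (by omega)
    have h2 := hPQ (m + 1) (by omega)
    have e1 := step (i + 1 + m)
    have e2 := step (i + 1 + (N - 1 - m))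
    rw [show i + 1 + (N - 1 - m) + 1 = i + 1 + (N - m) by omega] at e2
    rw [show N - (m + 1) = N - 1 - m by omega, ← Nat.add_assoc] at h2
    rcases e1 with e1 | e1 <;> rcases e2 with e2 | e2
    · rw [e1.1, e2.1]
    · omega
    · omega
    · rw [e1.1, e2.1]
  obtain ⟨p, q, hpq, hpq'⟩ := hw.exists_rightSpecial (N + 1)
  -- The suffix of length `N` of the right special factor is right special.
  have hsuf : factorAt w (p + 1) N = factorAt w (i + 1) N := by
    refine hw.rightSpecial_unique (i' := q + 1) (j' := j + 1) ?_ ?_ (factorAt_eq_iff.2 hB) ?_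
    · rw [factorAt_succ', factorAt_succ'] at hpq
      exact (List.cons.inj hpq).2
    · rw [Nat.add_right_comm, Nat.add_right_comm q]
      exact hpq'
    · rw [Nat.add_right_comm, Nat.add_right_comm j, hi1.1, hi1.2]
      exact hab.symm
  -- The right special factor is `a B` or `b B`; its first letter decides which window plays `d B d`
  -- in the obstruction.
  rcases h p with hp | hp
  · refine hw.palindrome_obstruction (N := N) (i := i) (j := j) ?_ ?_ hB hpal ?_
    · rw [hi0.1, hi0.2]
      exact hab.symm
    · rw [hi0.1, hi1.1]
    · intro p' q' h1 h2
      rw [hw.rightSpecial_unique h1 h2 hpq hpq', factorAt_succ', factorAt_succ', hsuf, hp,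
        hi0.2, factorAt_eq_iff.2 hB]
  · refine hw.palindrome_obstruction (N := N) (i := j) (j := i) ?_ ?_
      (fun m hm => (hB m hm).symm) ?_ ?_
    · rw [hi0.1, hi0.2]
      exact hab
    · rw [hi0.2, hi1.2]
    · intro m hm
      rw [← hB m hm, ← hB (N - 1 - m) (by omega)]
      exact hpal m hm
    · intro p' q' h1 h2
      rw [hw.rightSpecial_unique h1 h2 hpq hpq', factorAt_succ', factorAt_succ', hsuf, hp,
        hi0.1]

end Balance

/-! ### From balance to an irrational rotation -/

section Rotation

/-- A balanced integer sequence has a slope, from which it deviates by at most one. -/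
theorem exists_slope {S : ℕ → ℤ} (hS : ∀ n i j, S (i + n) - S i ≤ S (j + n) - S j + 1) :
    ∃ α : ℝ, ∀ i n : ℕ, |((S (i + n) - S i : ℤ) : ℝ) - n * α| ≤ 1 := by
  have hlow : ∀ n l i : ℕ, (l : ℤ) * (S (i + n) - S i - 1) ≤ S (l * n) - S 0 := by
    intro n l i
    induction l with
    | zero => simp
    | succ l ih =>
      have := hS n i (l * n)
      rw [Nat.succ_mul]
      push_cast
      linarith
  have hupp : ∀ n l i : ℕ, S (l * n) - S 0 ≤ (l : ℤ) * (S (i + n) - S i + 1) := by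
    intro n l i
    induction l with
    | zero => simp
    | succ l ih =>
      have := hS n (l * n) i
      rw [Nat.succ_mul]
      push_cast
      linarith
  -- Both sides are compared with the mean over a window of length `(n + 1) * (m + 1)`, cut into
  -- blocks of either length. The slope is the supremum of the left sides.
  have key : ∀ n m i j : ℕ, ((S (i + (n + 1)) - S i - 1 : ℤ) : ℝ) / (n + 1 : ℕ) ≤
      ((S (j + (m + 1)) - S j + 1 : ℤ) : ℝ) / (m + 1 : ℕ) := by
    intro n m i j
    rw [div_le_div_iff₀ (by positivity) (by positivity)]
    have h1 := hlow (n + 1) (m + 1) i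
    have h2 := hupp (m + 1) (n + 1) j
    rw [Nat.mul_comm (n + 1)] at h2
    have h3 := h1.trans h2
    rw [mul_comm, mul_comm _ ((n + 1 : ℕ) : ℝ)]
    exact_mod_cast h3
  let f : ℕ × ℕ → ℝ := fun q => ((S (q.2 + (q.1 + 1)) - S q.2 - 1 : ℤ) : ℝ) / (q.1 + 1 : ℕ)
  have hbdd : BddAbove (Set.range f) :=
    ⟨_, by rintro _ ⟨q, rfl⟩; exact key q.1 0 q.2 0⟩
  refine ⟨⨆ q, f q, fun i n => ?_⟩
  rcases n with _ | n
  · simp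
  have h1 : ((S (i + (n + 1)) - S i - 1 : ℤ) : ℝ) / (n + 1 : ℕ) ≤ ⨆ q, f q := le_ciSup hbdd (n, i)
  have h2 : ⨆ q, f q ≤ ((S (i + (n + 1)) - S i + 1 : ℤ) : ℝ) / (n + 1 : ℕ) :=
    ciSup_le fun q => key q.1 n q.2 i
  have hpos : (0 : ℝ) < (n + 1 : ℕ) := by positivity
  rw [div_le_iff₀ hpos] at h1
  rw [le_div_iff₀ hpos] at h2
  rw [abs_le]
  push_cast at *
  constructor <;> linarith

/-- The deviation of an integer sequence from the line of slope `α`. -/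
noncomputable def deviation (S : ℕ → ℤ) (α : ℝ) (i : ℕ) : ℝ := i * α - S i

theorem deviation_add (S : ℕ → ℤ) (α : ℝ) (i p : ℕ) :
    deviation S α (i + p) - deviation S α i = p * α - (S (i + p) - S i : ℤ) := by
  unfold deviation
  push_cast
  ring

theorem exists_deviation_bounds {S : ℕ → ℤ} {α : ℝ}
    (h : ∀ i n : ℕ, |((S (i + n) - S i : ℤ) : ℝ) - n * α| ≤ 1) :
    ∃ lo : ℝ, ∀ i, lo ≤ deviation S α i ∧ deviation S α i ≤ lo + 1 := by
  have hosc : ∀ i j, deviation S α i - 1 ≤ deviation S α j := by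
    intro i j
    rcases le_total i j with hij | hij
    · obtain ⟨p, rfl⟩ := Nat.exists_eq_add_of_le hij
      have h1 := deviation_add S α i p
      have h2 := abs_le.1 (h i p)
      linarith
    · obtain ⟨p, rfl⟩ := Nat.exists_eq_add_of_le hij
      have h1 := deviation_add S α j p
      have h2 := abs_le.1 (h j p)
      linarith
  refine ⟨⨅ i, deviation S α i, fun i => ⟨ciInf_le ⟨deviation S α 0 - 1, ?_⟩ i, ?_⟩⟩
  · rintro _ ⟨j, rfl⟩
    exact hosc 0 j
  · have := le_ciInf (hosc i)
    linarith

/-- If a balanced sequence has rational slope, then its increments are eventually periodic. -/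
theorem eventually_periodic_of_slope {S : ℕ → ℤ} {α lo : ℝ}
    (hS : ∀ n i j, S (i + n) - S i ≤ S (j + n) - S j + 1)
    (hlo : ∀ i, lo ≤ deviation S α i ∧ deviation S α i ≤ lo + 1) (hα : ¬ Irrational α) :
    ∃ N p, 0 < p ∧ ∀ i, N ≤ i → S (i + p + 1) - S (i + p) = S (i + 1) - S i := by
  obtain ⟨r, rfl⟩ : ∃ r : ℚ, (r : ℝ) = α := by
    simpa [Irrational] using hα
  have hq : (0 : ℝ) < r.den := by exact_mod_cast r.den_pos
  have hqr : (r.den : ℝ) * (r : ℝ) = r.num := by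
    exact_mod_cast r.den_mul_eq_num
  set q := r.den with hqdef
  have hdev : ∀ i, deviation S r (i + q) - deviation S r i = (r.num - (S (i + q) - S i) : ℤ) := by
    intro i
    rw [deviation_add, hqr]
    push_cast
    ring
  -- the increments over a period all lie on one side of the mean
  obtain ⟨e, he, hsign⟩ : ∃ e : ℤ, (e = 1 ∨ e = -1) ∧ ∀ i, 0 ≤ e * (r.num - (S (i + q) - S i)) := by
    by_cases hc : ∀ i, 0 ≤ r.num - (S (i + q) - S i)
    · exact ⟨1, Or.inl rfl, by simpa using hc⟩
    · push Not at hc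
      obtain ⟨j, hj⟩ := hc
      refine ⟨-1, Or.inr rfl, fun i => ?_⟩
      have := hS q j i
      linarith
  have habs : |(e : ℝ)| = 1 := by
    rcases he with rfl | rfl <;> simp
  -- The sum telescopes to `q` differences of deviations, each at most 1 in absolute value.
  -- Nonnegative integers with bounded partial sums are eventually zero.
  have hsum : ∀ n, ∑ i ∈ Finset.range n, ((e * (r.num - (S (i + q) - S i)) : ℤ) : ℝ) ≤ q := by
    intro n
    have h1 : ∀ n, ∑ i ∈ Finset.range n, ((e * (r.num - (S (i + q) - S i)) : ℤ) : ℝ) =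
        e * ∑ k ∈ Finset.range q, (deviation S r (k + n) - deviation S r k) := by
      intro n
      induction n with
      | zero => simp
      | succ n ih =>
        rw [Finset.sum_range_succ, ih, Int.cast_mul, ← hdev, ← mul_add]
        congr 1
        have h2 := Finset.sum_range_sub (fun k => deviation S r (k + n)) q
        simp only [Finset.sum_sub_distrib] at h2 ⊢
        have h3 : ∀ k, k + 1 + n = k + (n + 1) := fun k => by omega
        simp only [h3, Nat.add_comm q n, zero_add] at h2
        linarith
    rw [h1]
    refine (le_abs_self _).trans ?_
    rw [abs_mul, habs, one_mul]
    refine (Finset.abs_sum_le_sum_abs _ _).trans ?_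
    refine (Finset.sum_le_card_nsmul _ _ 1 fun k _ => ?_).trans (by simp)
    rw [abs_le]
    constructor <;> linarith [hlo (k + n), hlo k]
  have htend := (summable_of_sum_range_le (fun i => by exact_mod_cast hsign i)
    hsum).tendsto_atTop_zero
  have hev := htend.eventually (gt_mem_nhds (zero_lt_one (α := ℝ)))
  rw [Filter.eventually_atTop] at hev
  obtain ⟨N, hN⟩ := hev
  have hconst : ∀ i, N ≤ i → S (i + q) - S i = r.num := by
    intro i hi
    have h1 : e * (r.num - (S (i + q) - S i)) < 1 := by exact_mod_cast hN i hi
    have h2 := hsign i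
    rcases he with rfl | rfl <;> linarith
  refine ⟨N, q, r.den_pos, fun i hi => ?_⟩
  have h1 := hconst i hi
  have h2 := hconst (i + 1) (by omega)
  rw [Nat.add_right_comm] at h2
  linarith

/-- The integer sequence `S` deviates from the line of irrational slope `α` by values in the
interval `[lo, lo + 1]`. -/
structure IsCutting (S : ℕ → ℤ) (α lo : ℝ) : Prop where
  irrational : Irrational α
  lower : ∀ i, lo ≤ deviation S α i
  upper : ∀ i, deviation S α i ≤ lo + 1

theorem IsSturmian.exists_isCutting {A : Type*} {w : ℕ → A} (hw : IsSturmian w) {a b : A}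
    (hab : a ≠ b) (h : ∀ i, w i = a ∨ w i = b) :
    ∃ α lo, IsCutting (prefixCount w b) α lo := by
  have hbal := hw.balanced hab h
  obtain ⟨α, hα⟩ := exists_slope hbal
  obtain ⟨lo, hlo⟩ := exists_deviation_bounds hα
  refine ⟨α, lo, ?_, fun i => (hlo i).1, fun i => (hlo i).2⟩
  by_contra hirr
  obtain ⟨N, p, hp, hper⟩ := eventually_periodic_of_slope hbal hlo hirr
  refine hw.not_eventually_periodic (N := N) hp fun i hi => ?_
  have h1 := hper i hi
  rcases h i with h2 | h2 <;> rcases h (i + p) with h3 | h3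
  · rw [h2, h3]
  · rw [prefixCount_succ_of_eq h3, prefixCount_succ_of_ne (h2.trans_ne hab)] at h1
    omega
  · rw [prefixCount_succ_of_eq h2, prefixCount_succ_of_ne (h3.trans_ne hab)] at h1
    omega
  · rw [h2, h3]

/-- `δ` is congruent to `p * α` modulo `1`. -/
def IsShift (α : ℝ) (p : ℕ) (δ : ℝ) : Prop := ∃ m : ℤ, δ = p * α + m

namespace IsShift

variable {α δ δ' : ℝ} {p q : ℕ}

theorem eq_of_abs_lt (h : IsShift α p δ) (h' : IsShift α p δ') (hlt : |δ - δ'| < 1) :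
    δ = δ' := by
  obtain ⟨m, rfl⟩ := h
  obtain ⟨m', rfl⟩ := h'
  have : |((m - m' : ℤ) : ℝ)| < 1 := by
    rw [show ((m - m' : ℤ) : ℝ) = p * α + m - (p * α + m') by push_cast; ring]
    exact hlt
  rw [← Int.cast_abs] at this
  have h0 : |m - m'| < 1 := by exact_mod_cast this
  rw [Int.abs_lt_one_iff] at h0
  rw [show m = m' by omega]

theorem sub (h : IsShift α p δ) (h' : IsShift α q δ') (hqp : q ≤ p) :
    IsShift α (p - q) (δ - δ') := by
  obtain ⟨m, rfl⟩ := h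
  obtain ⟨m', rfl⟩ := h'
  exact ⟨m - m', by push_cast [hqp]; ring⟩

theorem add (h : IsShift α p δ) (h' : IsShift α q δ') : IsShift α (p + q) (δ + δ') := by
  obtain ⟨m, rfl⟩ := h
  obtain ⟨m', rfl⟩ := h'
  exact ⟨m + m', by push_cast; ring⟩

/-- Irrationality lets a displacement determine its time. -/
theorem inj (hα : Irrational α) (h : IsShift α p δ) (h' : IsShift α q δ) : p = q := by
  obtain ⟨m, hm⟩ := h
  obtain ⟨m', hm'⟩ := h'
  by_contra hne
  have hne' : ((p : ℤ) - q : ℤ) ≠ 0 := by omega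
  have h1 := (hα.intCast_mul hne').ne_int (m' - m)
  apply h1
  push_cast
  linarith

end IsShift

theorem isShift_fract (α : ℝ) (n : ℕ) : IsShift α n (Int.fract (n * α)) :=
  ⟨-⌊n * α⌋, by rw [Int.fract]; push_cast; ring⟩

namespace IsCutting

variable {S : ℕ → ℤ} {α lo : ℝ}

theorem isShift (S : ℕ → ℤ) (α : ℝ) (i p : ℕ) :
    IsShift α p (deviation S α (i + p) - deviation S α i) :=
  ⟨-(S (i + p) - S i), by rw [deviation_add]; push_cast; ring⟩

/-- A shift which keeps a point strictly inside the interval is the actual one. -/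
theorem deviation_add_eq (h : IsCutting S α lo) {i p : ℕ} {δ : ℝ} (hδ : IsShift α p δ)
    (h1 : lo < deviation S α i + δ) (h2 : deviation S α i + δ < lo + 1) :
    deviation S α (i + p) = deviation S α i + δ := by
  have h3 := (isShift S α i p).eq_of_abs_lt hδ (by
    rw [abs_lt]
    constructor <;> linarith [h.lower (i + p), h.upper (i + p)])
  linarith

/-- Density of the multiples of `α` on the circle; the target is moved back by `N * α` so that the
hit occurs at time at least `N`. -/
theorem exists_between (h : IsCutting S α lo) {l r : ℝ} (hl : lo ≤ l) (hr : r ≤ lo + 1)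
    (hlr : l < r) (N : ℕ) : ∃ i, N ≤ i ∧ l < deviation S α i ∧ deviation S α i < r := by
  have hd : DenseRange (fun n : ℕ => n • (α : AddCircle (1 : ℝ))) := by
    rw [← denseRange_zsmul_iff_nsmul, AddCircle.denseRange_zsmul_coe_iff, div_one]
    exact h.irrational
  have hopen : IsOpen ((fun z : ℝ => (z : AddCircle (1 : ℝ))) ''
      Set.Ioo (l - N * α) (r - N * α)) :=
    QuotientAddGroup.isOpenMap_coe _ isOpen_Ioo
  obtain ⟨n, z, hz, hzn⟩ := hd.exists_mem_open hopen
    ((Set.nonempty_Ioo.2 (by linarith)).image _)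
  replace hzn : (z : AddCircle (1 : ℝ)) = n • (α : AddCircle (1 : ℝ)) := hzn
  have hzn' : ((z - n * α : ℝ) : AddCircle (1 : ℝ)) = 0 := by
    rw [AddCircle.coe_sub, sub_eq_zero, hzn, ← nsmul_eq_mul, AddCircle.coe_nsmul]
  obtain ⟨m, hm⟩ := (AddCircle.coe_eq_zero_iff (1 : ℝ)).1 hzn'
  rw [zsmul_eq_mul, mul_one] at hm
  have h0 : deviation S α 0 = -S 0 := by simp [deviation]
  have hshift' : IsShift α (n + N) (z + N * α - deviation S α 0) :=
    ⟨m + S 0, by rw [h0]; push_cast; linarith⟩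
  have heq := h.deviation_add_eq (i := 0) hshift' (by linarith [hz.1]) (by linarith [hz.2])
  rw [zero_add] at heq
  exact ⟨n + N, by omega, by linarith [hz.1], by linarith [hz.2]⟩

end IsCutting

end Rotation

/-! ### First returns to the heavy positions -/

section Returns

/-- `i` and `i + p` are consecutive elements of `O`. -/
def IsFirstReturn (O : ℕ → Prop) (i p : ℕ) : Prop :=
  0 < p ∧ O i ∧ O (i + p) ∧ ∀ q, 0 < q → q < p → ¬ O (i + q)

theorem exists_isFirstReturn {O : ℕ → Prop} (hO : ∀ N, ∃ i, N ≤ i ∧ O i) {i : ℕ} (hi : O i) :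
    ∃ p, IsFirstReturn O i p := by
  classical
  have hex : ∃ p, 0 < p ∧ O (i + p) := by
    obtain ⟨j, hj, hj'⟩ := hO (i + 1)
    exact ⟨j - i, by omega, by rwa [Nat.add_sub_cancel' (by omega)]⟩
  exact ⟨Nat.find hex, (Nat.find_spec hex).1, hi, (Nat.find_spec hex).2,
    fun q hq hlt hOq => Nat.find_min hex hlt ⟨hq, hOq⟩⟩

theorem exists_isFirstReturn_of_lt {O : ℕ → Prop} {i j : ℕ} (hi : O i) (hj : O j)
    (hij : i < j) : ∃ i' p, i' + p = j ∧ IsFirstReturn O i' p := by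
  classical
  have hex : ∃ p, 0 < p ∧ p ≤ j ∧ O (j - p) :=
    ⟨j - i, by omega, by omega, by rwa [Nat.sub_sub_self (by omega)]⟩
  obtain ⟨h1, h2, h3⟩ := Nat.find_spec hex
  refine ⟨j - Nat.find hex, Nat.find hex, by omega, h1, h3, by rwa [Nat.sub_add_cancel h2],
    fun q hq hlt hOq => Nat.find_min hex (m := Nat.find hex - q) (by omega)
      ⟨by omega, by omega, ?_⟩⟩
  rwa [show j - (Nat.find hex - q) = j - Nat.find hex + q by omega]

/-- The window of length `n` at `i` has the larger of the two possible sums. -/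
def IsHeavy (S : ℕ → ℤ) (α : ℝ) (n i : ℕ) : Prop := S (i + n) - S i = ⌊n * α⌋ + 1

namespace IsCutting

variable {S : ℕ → ℤ} {α lo : ℝ} {n : ℕ}

theorem fract_pos (h : IsCutting S α lo) (hn : 0 < n) : 0 < Int.fract (n * α) := by
  refine lt_of_le_of_ne (Int.fract_nonneg _) fun h0 => ?_
  have h1 : IsShift α n 0 := h0 ▸ isShift_fract α n
  have h2 : IsShift α 0 0 := ⟨0, by simp⟩
  exact hn.ne' (h1.inj h.irrational h2)

theorem sub_eq_or (h : IsCutting S α lo) (hn : 0 < n) (i : ℕ) :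
    S (i + n) - S i = ⌊n * α⌋ ∨ S (i + n) - S i = ⌊n * α⌋ + 1 := by
  have h1 := deviation_add S α i n
  have h2 := h.fract_pos hn
  have h3 := Int.fract_lt_one (n * α)
  have h4 := Int.floor_add_fract (n * α)
  have h5 : ((⌊n * α⌋ - 1 : ℤ) : ℝ) < (S (i + n) - S i : ℤ) := by
    rw [Int.cast_sub, Int.cast_one]
    linarith [h.upper (i + n), h.lower i]
  have h6 : ((S (i + n) - S i : ℤ) : ℝ) < (⌊n * α⌋ + 2 : ℤ) := by
    rw [Int.cast_add, Int.cast_ofNat]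
    linarith [h.upper i, h.lower (i + n)]
  rw [Int.cast_lt] at h5 h6
  omega

theorem deviation_add_of_isHeavy {i : ℕ} (hi : IsHeavy S α n i) :
    deviation S α (i + n) = deviation S α i + Int.fract (n * α) - 1 := by
  have h1 := deviation_add S α i n
  rw [hi] at h1
  rw [Int.fract]
  push_cast at h1
  linarith

theorem deviation_add_of_not_isHeavy (h : IsCutting S α lo) (hn : 0 < n) {i : ℕ}
    (hi : ¬ IsHeavy S α n i) :
    deviation S α (i + n) = deviation S α i + Int.fract (n * α) := by
  have h1 := deviation_add S α i n
  rw [(h.sub_eq_or hn i).resolve_right hi] at h1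
  rw [Int.fract]
  linarith

theorem isHeavy_of_lt (h : IsCutting S α lo) (hn : 0 < n) {i : ℕ}
    (hi : lo + 1 - Int.fract (n * α) < deviation S α i) : IsHeavy S α n i := by
  by_contra hcon
  linarith [h.deviation_add_of_not_isHeavy hn hcon, h.upper (i + n)]

/-- Only a weak inequality holds, whereas `isHeavy_of_lt` needs a strict one: at the endpoint `lo +
1 - β` the deviation does not decide heaviness. -/
theorem le_of_isHeavy (h : IsCutting S α lo) {i : ℕ} (hi : IsHeavy S α n i) :
    lo + 1 - Int.fract (n * α) ≤ deviation S α i := by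
  linarith [deviation_add_of_isHeavy hi, h.lower (i + n)]

theorem frequently_isHeavy (h : IsCutting S α lo) (hn : 0 < n) (N : ℕ) :
    ∃ i, N ≤ i ∧ IsHeavy S α n i := by
  obtain ⟨i, hi, h1, -⟩ := h.exists_between (l := lo + 1 - Int.fract (n * α)) (r := lo + 1)
    (by linarith [Int.fract_lt_one (n * α)]) le_rfl (by linarith [h.fract_pos hn]) N
  exact ⟨i, hi, h.isHeavy_of_lt hn h1⟩

theorem abs_deviation_sub_lt (h : IsCutting S α lo) {i p : ℕ} (hp : 0 < p)
    (hi : IsHeavy S α n i) (hip : IsHeavy S α n (i + p)) :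
    |deviation S α (i + p) - deviation S α i| < Int.fract (n * α) := by
  have hsh := isShift S α i p
  have h1 := h.le_of_isHeavy hi
  have h2 := h.le_of_isHeavy hip
  refine lt_of_le_of_ne ?_ fun heq => ?_
  · rw [abs_le]
    constructor <;> linarith [h.upper i, h.upper (i + p)]
  · have h3 := isShift_fract α n
    rcases abs_choice (deviation S α (i + p) - deviation S α i) with h4 | h4
    · rw [h4] at heq
      rw [heq] at hsh
      obtain rfl := hsh.inj h.irrational h3
      linarith [deviation_add_of_isHeavy hi]
    · rw [h4] at heq
      have h5 := hsh.add h3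
      rw [← heq, add_neg_cancel] at h5
      have := h5.inj h.irrational ⟨0, by simp⟩ (q := 0)
      omega

theorem deviation_sub_ne_zero (h : IsCutting S α lo) {i p : ℕ} (hp : 0 < p) :
    deviation S α (i + p) - deviation S α i ≠ 0 := fun h0 => by
  have h1 := isShift S α i p
  rw [h0] at h1
  exact hp.ne' (h1.inj h.irrational ⟨0, by simp⟩)

/-- If all heavy windows of length `n` have the same increments, then the set of heavy positions
has exactly two types of first returns. -/
theorem two_returns (h : IsCutting S α lo) (hn : 0 < n)
    (hsing : ∀ i j, IsHeavy S α n i → IsHeavy S α n j → ∀ k ≤ n,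
      S (i + k) - S i = S (j + k) - S j) :
    ∃ p₁ p₂ : ℕ, ∃ c₁ c₂ : ℤ, p₁ ≠ p₂ ∧
      (∃ i, IsFirstReturn (IsHeavy S α n) i p₁ ∧ S (i + p₁) - S i = c₁) ∧
      (∃ i, IsFirstReturn (IsHeavy S α n) i p₂ ∧ S (i + p₂) - S i = c₂) ∧
      ∀ i p, IsFirstReturn (IsHeavy S α n) i p →
        (p = p₁ ∧ S (i + p) - S i = c₁) ∨ (p = p₂ ∧ S (i + p) - S i = c₂) := by
  classical
  have hβ0 := h.fract_pos hn
  have hβ1 := Int.fract_lt_one (n * α)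
  have hβ := isShift_fract α n
  have hheavy := fun i => h.isHeavy_of_lt hn (i := i)
  have hle := fun i => h.le_of_isHeavy (n := n) (i := i)
  have hnot := fun i => h.deviation_add_of_not_isHeavy hn (i := i)
  set β := Int.fract (n * α) with hβdef
  -- upward shifts take time greater than `n`
  have hup : ∀ p δ, 0 < p → 0 < δ → δ < β → IsShift α p δ → n < p := by
    intro p δ hp hδ0 hδβ hδ
    by_contra! hpn
    obtain ⟨i, -, hi1, hi2⟩ := h.exists_between (l := lo + 1 - β) (r := lo + 1 - δ)
      (by linarith) (by linarith) (by linarith) 0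
    obtain ⟨j, -, hj1, -⟩ := h.exists_between (l := lo + 1 - δ) (r := lo + 1)
      (by linarith) (by linarith) (by linarith) 0
    have h1 := h.deviation_add_eq (i := i) hδ (by linarith) (by linarith)
    have h2 := hsing i j (hheavy i hi1) (hheavy j (by linarith)) p hpn
    have h3 := deviation_add S α i p
    have h4 := deviation_add S α j p
    rw [h2] at h3
    linarith [h.upper (j + p)]
  have hdown : ∃ p, 0 < p ∧ ∃ t, 0 < t ∧ t < β ∧ IsShift α p (-t) := by
    obtain ⟨i, -, hi1, hi2⟩ := h.exists_between (l := lo + 1 - β / 2) (r := lo + 1)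
      (by linarith) (by linarith) (by linarith) 0
    obtain ⟨j, hj, hj1, hj2⟩ := h.exists_between (l := lo + 1 - β) (r := lo + 1 - β / 2)
      (by linarith) (by linarith) (by linarith) (i + 1)
    refine ⟨j - i, by omega, deviation S α i - deviation S α j, by linarith, by linarith, ?_⟩
    have := isShift S α i (j - i)
    rwa [Nat.add_sub_cancel' (by omega), ← neg_sub] at this
  obtain ⟨hτ0, t, ht0, htβ, ht⟩ := Nat.find_spec hdown
  have hmin : ∀ p s, 0 < p → 0 < s → s < β → IsShift α p (-s) → Nat.find hdown ≤ p :=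
    fun p s h1 h2 h3 h4 => Nat.find_min' hdown ⟨h1, s, h2, h3, h4⟩
  set τ := Nat.find hdown with hτ
  -- Time `n` is a shift by `β`, so an upward `δ` at time `p` is a downward `β - δ` at time `p - n`.
  have hup' : ∀ p δ, 0 < p → 0 < δ → δ < β → IsShift α p δ → n + τ ≤ p := by
    intro p δ hp hδ0 hδβ hδ
    have h1 := hup p δ hp hδ0 hδβ hδ
    have h2 := hδ.sub hβ h1.le
    have h3 := hmin (p - n) (β - δ) (by omega) (by linarith) (by linarith)
      (by rwa [neg_sub])
    omega
  have hup2 : IsShift α (n + τ) (β - t) := hβ.add ht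
  -- a first return is the shift by `-t` or the shift by `β - t`
  have hret : ∀ i p, IsFirstReturn (IsHeavy S α n) i p →
      (p = τ ∧ deviation S α (i + p) - deviation S α i = -t) ∨
      (p = n + τ ∧ deviation S α (i + p) - deviation S α i = β - t) := by
    rintro i p ⟨hp, hi, hip, hfirst⟩
    have hsh := isShift S α i p
    have hlt := abs_lt.1 (h.abs_deviation_sub_lt hp hi hip)
    have hne := h.deviation_sub_ne_zero (i := i) hp
    rw [← hβdef] at hlt
    have hile := hle i hi
    have hiple := hle (i + p) hip
    have hiu := h.upper i
    set d := deviation S α (i + p) - deviation S α i with hd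
    have caseτ : p = τ → d = -t := fun hpτ => by
      rw [hpτ] at hsh
      refine hsh.eq_of_abs_lt ht ?_
      rw [abs_lt]
      constructor
      · by_contra hcon
        have h0 : d < 0 := by linarith
        linarith
      · rcases lt_or_gt_of_ne hne with h0 | h0
        · linarith
        · have := hup' p d hp h0 hlt.2 (hpτ ▸ hsh)
          omega
    by_cases hτh : IsHeavy S α n (i + τ)
    · left
      have hpτ : p ≤ τ := by
        by_contra hcon
        exact hfirst τ hτ0 (by omega) hτh
      have : p = τ := by
        rcases lt_or_gt_of_ne hne with h0 | h0
        · have := hmin p (-d) hp (by linarith) (by linarith) (by rwa [neg_neg])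
          omega
        · have := hup' p d hp h0 hlt.2 hsh
          omega
      exact ⟨this, caseτ this⟩
    · have hle_t : deviation S α i - t ≤ lo + 1 - β := by
        by_contra! hcon
        apply hτh
        apply hheavy
        rw [h.deviation_add_eq (i := i) ht (by linarith) (by linarith)]
        linarith
      have hheavy2 : IsHeavy S α n (i + (n + τ)) := by
        apply hheavy
        rcases hle_t.lt_or_eq with h1 | h1
        · rw [h.deviation_add_eq (i := i) hup2 (by linarith) (by linarith)]
          linarith
        -- In this endpoint case the shift by `β - t` lands exactly on `lo + 1`, so the move is made
        -- in two stages, through `i + τ`.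
        · have h2 := h.deviation_add_eq (i := i) ht (by linarith) (by linarith)
          have h3 := hnot _ hτh
          rw [show i + (n + τ) = i + τ + n by omega]
          linarith
      have hpn : p ≤ n + τ := by
        by_contra hcon
        exact hfirst (n + τ) (by omega) (by omega) hheavy2
      rcases lt_or_gt_of_ne hne with h0 | h0
      · left
        suffices p = τ from ⟨this, caseτ this⟩
        have h1 := hmin p (-d) hp (by linarith) (by linarith) (by rwa [neg_neg])
        rcases (show -d ≤ t by linarith).lt_or_eq with h2 | h2
        · have hne' : p ≠ τ := fun hpτ => by linarith [caseτ hpτ]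
          have h3 := hup' (p - τ) (d - -t) (by omega) (by linarith) (by linarith)
            (hsh.sub ht h1)
          omega
        · rw [show d = -t by linarith] at hsh
          exact hsh.inj h.irrational ht
      · right
        have h1 := hup' p d hp h0 hlt.2 hsh
        have h2 : p = n + τ := by omega
        refine ⟨h2, ?_⟩
        rw [h2] at hsh
        refine hsh.eq_of_abs_lt hup2 ?_
        rw [abs_lt]
        constructor <;> linarith
  have hcount : ∀ i p q m δ, p = q → deviation S α (i + p) - deviation S α i = δ →
      δ = q * α + (m : ℤ) → S (i + p) - S i = -m := by
    rintro i p q m δ rfl h1 h2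
    have h3 := deviation_add S α i p
    have h4 : ((S (i + p) - S i : ℤ) : ℝ) = (-m : ℤ) := by
      rw [Int.cast_neg]
      linarith
    exact_mod_cast h4
  obtain ⟨m₁, hm₁⟩ := ht
  obtain ⟨m₂, hm₂⟩ := hup2
  refine ⟨τ, n + τ, -m₁, -m₂, by omega, ?_, ?_, fun i p hip => ?_⟩
  · obtain ⟨i, -, hi1, hi2⟩ := h.exists_between (l := lo + 1 - β + t) (r := lo + 1)
      (by linarith) (by linarith) (by linarith) 0
    obtain ⟨p, hp⟩ := exists_isFirstReturn (h.frequently_isHeavy hn) (hheavy i (by linarith))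
    have hτh : IsHeavy S α n (i + τ) := by
      apply hheavy
      rw [h.deviation_add_eq (i := i) ⟨m₁, hm₁⟩ (by linarith) (by linarith)]
      linarith
    rcases hret i p hp with ⟨rfl, h2⟩ | ⟨rfl, h2⟩
    · exact ⟨i, hp, hcount _ _ _ _ _ rfl h2 hm₁⟩
    · exact absurd hτh (hp.2.2.2 τ hτ0 (by omega))
  · obtain ⟨i, -, hi1, hi2⟩ := h.exists_between (l := lo + 1 - β) (r := lo + 1 - β + t)
      (by linarith) (by linarith) (by linarith) 0
    obtain ⟨p, hp⟩ := exists_isFirstReturn (h.frequently_isHeavy hn) (hheavy i (by linarith))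
    rcases hret i p hp with ⟨rfl, h2⟩ | ⟨rfl, h2⟩
    · linarith [hle _ hp.2.2.1]
    · exact ⟨i, hp, hcount _ _ _ _ _ rfl h2 hm₂⟩
  · rcases hret i p hip with ⟨h1, h2⟩ | ⟨h1, h2⟩
    · exact Or.inl ⟨h1, hcount _ _ _ _ _ h1 h2 hm₁⟩
    · exact Or.inr ⟨h1, hcount _ _ _ _ _ h1 h2 hm₂⟩

/-- If the set of heavy positions has at most two types of first returns, then a return time of
an upward move exceeds `n`. -/
theorem lt_of_upward_return (h : IsCutting S α lo) (hn : 0 < n) {p₁ p₂ : ℕ} {c₁ c₂ : ℤ}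
    (hret : ∀ i p, IsFirstReturn (IsHeavy S α n) i p →
      (p = p₁ ∧ S (i + p) - S i = c₁) ∨ (p = p₂ ∧ S (i + p) - S i = c₂))
    {i p : ℕ} (hip : IsFirstReturn (IsHeavy S α n) i p)
    (hlt : deviation S α i < deviation S α (i + p)) : n < p := by
  have hβ0 := h.fract_pos hn
  have hβ1 := Int.fract_lt_one (n * α)
  have hβ := isShift_fract α n
  have hheavy := fun i => h.isHeavy_of_lt hn (i := i)
  have hle := fun i => h.le_of_isHeavy (n := n) (i := i)
  set β := Int.fract (n * α) with hβdef
  have hfreq := h.frequently_isHeavy hn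
  wlog hp : p = p₁ ∧ S (i + p) - S i = c₁ generalizing p₁ p₂ c₁ c₂
  · exact this (fun i p hip => (hret i p hip).symm) ((hret i p hip).resolve_left hp)
  obtain ⟨rfl, hc₁⟩ := hp
  obtain ⟨t₁, ht₁⟩ : ∃ t₁, t₁ = deviation S α (i + p) - deviation S α i := ⟨_, rfl⟩
  have ht₁0 : 0 < t₁ := by linarith
  have hsh₁ : IsShift α p t₁ := ht₁ ▸ isShift S α i p
  have ht₁β : t₁ < β := by
    have := (abs_lt.1 (h.abs_deviation_sub_lt hip.1 hip.2.1 hip.2.2.1)).2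
    rwa [← ht₁] at this
  have hdev₁ : ∀ j, S (j + p) - S j = c₁ → deviation S α (j + p) - deviation S α j = t₁ := by
    intro j hj
    rw [ht₁, deviation_add, deviation_add, hj, hc₁]
  -- near the top, there is a downward return
  obtain ⟨j, hj, hjd⟩ : ∃ j, IsFirstReturn (IsHeavy S α n) j p₂ ∧ S (j + p₂) - S j = c₂ ∧
      deviation S α (j + p₂) < deviation S α j := by
    by_cases hup : ∃ j, IsFirstReturn (IsHeavy S α n) j p₂ ∧ S (j + p₂) - S j = c₂ ∧
      deviation S α j < deviation S α (j + p₂)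
    · obtain ⟨j, hj, hj1, hj2⟩ := hup
      have hβ2 := (abs_lt.1 (h.abs_deviation_sub_lt hj.1 hj.2.1 hj.2.2.1)).2
      rw [← hβdef] at hβ2
      obtain ⟨k, -, hk1, -⟩ := h.exists_between
        (l := lo + 1 - min t₁ (deviation S α (j + p₂) - deviation S α j)) (r := lo + 1)
        (by linarith [min_le_left t₁ (deviation S α (j + p₂) - deviation S α j)])
        le_rfl (by
          have := lt_min ht₁0 (sub_pos.2 hj2)
          linarith) 0
      have hm1 := min_le_left t₁ (deviation S α (j + p₂) - deviation S α j)
      have hm2 := min_le_right t₁ (deviation S α (j + p₂) - deviation S α j)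
      obtain ⟨q, hq⟩ := exists_isFirstReturn hfreq (hheavy k (by linarith))
      rcases hret k q hq with ⟨rfl, h2⟩ | ⟨rfl, h2⟩
      · linarith [hdev₁ k h2, h.upper (k + q)]
      · have h3 := deviation_add S α k q
        have h4 := deviation_add S α j q
        rw [h2] at h3
        rw [hj1] at h4
        linarith [h.upper (k + q)]
    · obtain ⟨k, -, hk1, -⟩ := h.exists_between (l := lo + 1 - t₁) (r := lo + 1)
        (by linarith) le_rfl (by linarith) 0
      obtain ⟨q, hq⟩ := exists_isFirstReturn hfreq (hheavy k (by linarith))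
      rcases hret k q hq with ⟨rfl, h2⟩ | ⟨rfl, h2⟩
      · linarith [hdev₁ k h2, h.upper (k + q)]
      · push Not at hup
        refine ⟨k, hq, h2, lt_of_le_of_ne (hup k hq h2) fun heq => ?_⟩
        exact h.deviation_sub_ne_zero (i := k) hq.1 (sub_eq_zero.2 heq)
  obtain ⟨hc₂, hjd⟩ := hjd
  obtain ⟨t₂, ht₂⟩ : ∃ t₂, t₂ = deviation S α j - deviation S α (j + p₂) := ⟨_, rfl⟩
  have ht₂0 : 0 < t₂ := by linarith
  have hsh₂ : IsShift α p₂ (-t₂) := by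
    rw [ht₂, neg_sub]
    exact isShift S α j p₂
  have ht₂β : t₂ < β := by
    have := (abs_lt.1 (h.abs_deviation_sub_lt hj.1 hj.2.1 hj.2.2.1)).1
    linarith
  have hdev₂ : ∀ k, S (k + p₂) - S k = c₂ →
      deviation S α (k + p₂) - deviation S α k = -t₂ := by
    intro k hk
    rw [ht₂, neg_sub, deviation_add, deviation_add, hk, hc₂]
  have hret' : ∀ k q, IsFirstReturn (IsHeavy S α n) k q →
      (q = p ∧ deviation S α (k + q) - deviation S α k = t₁) ∨
      (q = p₂ ∧ deviation S α (k + q) - deviation S α k = -t₂) := by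
    intro k q hq
    rcases hret k q hq with ⟨rfl, h2⟩ | ⟨rfl, h2⟩
    · exact Or.inl ⟨rfl, hdev₁ k h2⟩
    · exact Or.inr ⟨rfl, hdev₂ k h2⟩
  -- every interval contains the end of a first return
  have hpred : ∀ l r, lo + 1 - β ≤ l → r ≤ lo + 1 → l < r → ∃ k q,
      IsFirstReturn (IsHeavy S α n) k q ∧ l < deviation S α (k + q) ∧
      deviation S α (k + q) < r := by
    intro l r hl hr hlr
    obtain ⟨k, hk1, hk2, hk3⟩ := h.exists_between (by linarith) hr hlr (i + 1)
    obtain ⟨k', q, rfl, hq⟩ := exists_isFirstReturn_of_lt hip.2.1 (hheavy k (by linarith))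
      (by omega)
    exact ⟨k', q, hq, hk2, hk3⟩
  -- If the sum is too small, some return of the longer type passes a heavy position at the shorter
  -- time. If it is too large, some heavy position has room for neither move.
  have hsum : t₁ + t₂ = β := by
    rcases lt_trichotomy (t₁ + t₂) β with hlt | heq | hgt
    · exfalso
      rcases lt_trichotomy p p₂ with hpp | hpp | hpp
      · obtain ⟨k, q, hq, hk1, hk2⟩ := hpred (lo + 1 - β)
          (min (lo + 1 - β + t₁) (lo + 1 - t₁ - t₂)) le_rfl
          ((min_le_right _ _).trans (by linarith)) (lt_min (by linarith) (by linarith))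
        have hk3 := hk2.trans_le (min_le_left _ _)
        have hk4 := hk2.trans_le (min_le_right _ _)
        rcases hret' k q hq with ⟨rfl, h2⟩ | ⟨rfl, h2⟩
        · linarith [hle k hq.2.1]
        · refine hq.2.2.2 p hip.1 hpp (hheavy _ ?_)
          have := hle k hq.2.1
          rw [h.deviation_add_eq hsh₁ (by linarith) (by linarith)]
          linarith
      · subst hpp
        have := hsh₁.eq_of_abs_lt hsh₂ (by rw [abs_lt]; constructor <;> linarith)
        linarith
      · obtain ⟨k, q, hq, hk1, hk2⟩ := hpred
          (max (lo + 1 - t₂) (lo + 1 - β + t₁ + t₂)) (lo + 1)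
          (by linarith [le_max_left (lo + 1 - t₂) (lo + 1 - β + t₁ + t₂)])
          le_rfl (max_lt (by linarith) (by linarith))
        have hk3 := (le_max_left _ _).trans_lt hk1
        have hk4 := (le_max_right _ _).trans_lt hk1
        rcases hret' k q hq with ⟨rfl, h2⟩ | ⟨rfl, h2⟩
        · refine hq.2.2.2 p₂ hj.1 hpp (hheavy _ ?_)
          have := h.upper k
          rw [h.deviation_add_eq hsh₂ (by linarith) (by linarith)]
          linarith
        · linarith [h.upper k]
    · exact heq
    · exfalso
      obtain ⟨k, -, hk1, hk2⟩ := h.exists_between (l := max (lo + 1 - t₁) (lo + 1 - β))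
        (r := min (lo + 1) (lo + 1 - β + t₂))
        (by linarith [le_max_right (lo + 1 - t₁) (lo + 1 - β)]) (min_le_left _ _)
        (max_lt (lt_min (by linarith) (by linarith)) (lt_min (by linarith) (by linarith))) 0
      have hk3 := (le_max_left _ _).trans_lt hk1
      have hk4 := (le_max_right _ _).trans_lt hk1
      have hk5 := hk2.trans_le (min_le_right _ _)
      obtain ⟨q, hq⟩ := exists_isFirstReturn hfreq (hheavy k hk4)
      rcases hret' k q hq with ⟨rfl, h2⟩ | ⟨rfl, h2⟩
      · linarith [h.upper (k + q)]
      · linarith [hle _ hq.2.2.1]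
  have h1 : IsShift α (n + p₂) t₁ := by
    have := hβ.add hsh₂
    rwa [← hsum, add_neg_cancel_right] at this
  have h2 := hsh₁.inj h.irrational h1
  have := hj.1
  omega

/-- If two heavy windows of length `n` have different increments, then the set of heavy positions
has more than two types of first returns. -/
theorem not_two_returns (h : IsCutting S α lo) (hn : 0 < n) {p₁ p₂ : ℕ} {c₁ c₂ : ℤ}
    (hret : ∀ i p, IsFirstReturn (IsHeavy S α n) i p →
      (p = p₁ ∧ S (i + p) - S i = c₁) ∨ (p = p₂ ∧ S (i + p) - S i = c₂))
    {i p : ℕ} (hp : 0 < p) (hpn : p ≤ n) (hi : IsHeavy S α n i) (hip : IsHeavy S α n (i + p))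
    (hlt : deviation S α i < deviation S α (i + p)) : False := by
  -- Cutting an upward move at an intermediate heavy position leaves an upward piece, so some upward
  -- first return has time at most `n`.
  induction p using Nat.strong_induction_on generalizing i with
  | _ p ih =>
    by_cases hfirst : ∃ q, 0 < q ∧ q < p ∧ IsHeavy S α n (i + q)
    · obtain ⟨q, hq0, hqp, hq⟩ := hfirst
      have hqp' : i + q + (p - q) = i + p := by omega
      by_cases hlt' : deviation S α i < deviation S α (i + q)
      · exact ih q hqp hq0 (by omega) hi hq hlt'
      · refine ih (p - q) (by omega) (by omega) (by omega) hq (by rwa [hqp']) ?_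
        rw [hqp']
        linarith
    · push Not at hfirst
      have := h.lt_of_upward_return hn hret ⟨hp, hi, hip, hfirst⟩ hlt
      omega

end IsCutting

end Returns

/-! ### Back to words: returns, singularity and shape -/

section Main

variable {A : Type*} {w : ℕ → A}

/-- Exchanging the letters negates the deviation. -/
theorem IsCutting.complement {a b : A} {α lo : ℝ} (hab : a ≠ b) (h : ∀ i, w i = a ∨ w i = b)
    (hc : IsCutting (prefixCount w b) α lo) :
    IsCutting (prefixCount w a) (1 - α) (-(lo + 1)) := by
  have hdev : ∀ i, deviation (prefixCount w a) (1 - α) i = -deviation (prefixCount w b) α i := by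
    intro i
    have h1 : ((prefixCount w a i : ℤ) : ℝ) + (prefixCount w b i : ℤ) = i := by
      exact_mod_cast prefixCount_add_prefixCount hab h i
    unfold deviation
    linarith
  refine ⟨by simpa using hc.irrational.ratCast_sub 1, fun i => ?_, fun i => ?_⟩
  · rw [hdev]
    linarith [hc.upper i]
  · rw [hdev]
    linarith [hc.lower i]

/-- Each window is heavy with respect to one of the two letters. -/
theorem IsSturmian.exists_isHeavy (hw : IsSturmian w) (i : ℕ) {n : ℕ} (hn : 0 < n) :
    ∃ a b : A, ∃ α lo : ℝ, a ≠ b ∧ (∀ k, w k = a ∨ w k = b) ∧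
      IsCutting (prefixCount w b) α lo ∧ IsHeavy (prefixCount w b) α n i := by
  obtain ⟨a, b, hab, h⟩ := hw.exists_letters
  obtain ⟨α, lo, hc⟩ := hw.exists_isCutting hab h
  by_cases hi : IsHeavy (prefixCount w b) α n i
  · exact ⟨a, b, α, lo, hab, h, hc, hi⟩
  have hc' := hc.complement hab h
  refine ⟨b, a, 1 - α, -(lo + 1), hab.symm, fun k => (h k).symm, hc', ?_⟩
  by_contra hi'
  have h1 := hc.deviation_add_of_not_isHeavy hn hi
  have h2 := hc'.deviation_add_of_not_isHeavy hn hi'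
  have h3 := hc.fract_pos hn
  have h4 := hc'.fract_pos hn
  have h5 := deviation_add (prefixCount w b) α i n
  have h6 := deviation_add (prefixCount w a) (1 - α) i n
  have h7 := prefixCount_add_prefixCount hab h i
  have h8 := prefixCount_add_prefixCount hab h (i + n)
  have h9 : (((prefixCount w a (i + n) - prefixCount w a i : ℤ) : ℝ)) +
      (prefixCount w b (i + n) - prefixCount w b i : ℤ) = n := by
    have : prefixCount w a (i + n) - prefixCount w a i +
        (prefixCount w b (i + n) - prefixCount w b i) = n := by
      push_cast at h8
      linarith
    exact_mod_cast this
  linarith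

section Heavy

variable {a b : A} {α lo : ℝ} {n i₀ : ℕ}

theorem abelianOccursAt_iff_isHeavy (hab : a ≠ b) (h : ∀ k, w k = a ∨ w k = b)
    (hi₀ : IsHeavy (prefixCount w b) α n i₀) (i : ℕ) :
    AbelianOccursAt w (factorAt w i₀ n) i ↔ IsHeavy (prefixCount w b) α n i := by
  rw [AbelianOccursAt, AbelianEquiv, length_factorAt, factorAt_perm_iff hab h, hi₀]
  simp [IsHeavy]

theorem mem_abelianReturns_iff (hab : a ≠ b) (h : ∀ k, w k = a ∨ w k = b)
    (hi₀ : IsHeavy (prefixCount w b) α n i₀) (m : Multiset A) :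
    m ∈ abelianReturns w (factorAt w i₀ n) ↔ ∃ i p,
      IsFirstReturn (IsHeavy (prefixCount w b) α n) i p ∧ m = (factorAt w i p : Multiset A) := by
  simp only [abelianReturns, Set.mem_ofPred_eq, abelianOccursAt_iff_isHeavy hab h hi₀]
  constructor
  · rintro ⟨i, j, hij, hi, hj, hfirst, rfl⟩
    refine ⟨i, j - i, ⟨by omega, hi, by rwa [Nat.add_sub_cancel' hij.le], fun q h1 h2 => ?_⟩, rfl⟩
    exact hfirst (i + q) (by omega) (by omega)
  · rintro ⟨i, p, ⟨hp, hi, hip, hfirst⟩, rfl⟩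
    refine ⟨i, i + p, by omega, hi, hip, fun k h1 h2 => ?_, by rw [Nat.add_sub_cancel_left]⟩
    have := hfirst (k - i) (by omega) (by omega)
    rwa [Nat.add_sub_cancel' h1.le] at this

theorem coe_factorAt_eq_iff (hab : a ≠ b) (h : ∀ k, w k = a ∨ w k = b) {i j p q : ℕ} :
    (factorAt w i p : Multiset A) = factorAt w j q ↔
      p = q ∧ prefixCount w b (i + p) - prefixCount w b i =
        prefixCount w b (j + q) - prefixCount w b j := by
  rw [Multiset.coe_eq_coe, factorAt_perm_iff hab h]

theorem factorAt_eq_of_isSingular (hab : a ≠ b) (h : ∀ k, w k = a ∨ w k = b)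
    (hi₀ : IsHeavy (prefixCount w b) α n i₀) (hsing : IsSingular w (factorAt w i₀ n)) {i : ℕ}
    (hi : IsHeavy (prefixCount w b) α n i) : factorAt w i n = factorAt w i₀ n :=
  hsing.2 _ (isFactor_factorAt w i n) ((factorAt_perm_iff hab h).2 ⟨rfl, hi.trans hi₀.symm⟩)

theorem ncard_abelianReturns_of_isSingular (hc : IsCutting (prefixCount w b) α lo) (hab : a ≠ b)
    (h : ∀ k, w k = a ∨ w k = b) (hn : 0 < n) (hi₀ : IsHeavy (prefixCount w b) α n i₀)
    (hsing : IsSingular w (factorAt w i₀ n)) :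
    (abelianReturns w (factorAt w i₀ n)).ncard = 2 := by
  obtain ⟨p₁, p₂, c₁, c₂, hne, ⟨i₁, hi₁, rfl⟩, ⟨i₂, hi₂, rfl⟩, hret⟩ :=
    hc.two_returns hn fun i j hi hj k hk => by
      have h1 := factorAt_eq_iff.1 ((factorAt_eq_of_isSingular hab h hi₀ hsing hi).trans
        (factorAt_eq_of_isSingular hab h hi₀ hsing hj).symm)
      have h2 : factorAt w i k = factorAt w j k :=
        factorAt_eq_iff.2 fun m hm => h1 m (by omega)
      exact ((factorAt_perm_iff hab h).1 (List.Perm.of_eq h2)).2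
  rw [Set.ncard_eq_two]
  refine ⟨factorAt w i₁ p₁, factorAt w i₂ p₂,
    fun heq => hne ((coe_factorAt_eq_iff hab h).1 heq).1, ?_⟩
  ext m
  rw [mem_abelianReturns_iff hab h hi₀, Set.mem_insert_iff, Set.mem_singleton_iff]
  constructor
  · rintro ⟨i, p, hip, rfl⟩
    rw [coe_factorAt_eq_iff hab h, coe_factorAt_eq_iff hab h]
    exact hret i p hip
  · rintro (rfl | rfl)
    · exact ⟨i₁, p₁, hi₁, rfl⟩
    · exact ⟨i₂, p₂, hi₂, rfl⟩

theorem isSingular_of_ncard_abelianReturns (hc : IsCutting (prefixCount w b) α lo) (hab : a ≠ b)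
    (h : ∀ k, w k = a ∨ w k = b) (hn : 0 < n) (hi₀ : IsHeavy (prefixCount w b) α n i₀)
    (hcard : (abelianReturns w (factorAt w i₀ n)).ncard = 2) :
    IsSingular w (factorAt w i₀ n) := by
  classical
  obtain ⟨m₁, m₂, -, hset⟩ := Set.ncard_eq_two.1 hcard
  have hm₁ : m₁ ∈ abelianReturns w (factorAt w i₀ n) := by rw [hset]; simp
  have hm₂ : m₂ ∈ abelianReturns w (factorAt w i₀ n) := by rw [hset]; simp
  rw [mem_abelianReturns_iff hab h hi₀] at hm₁ hm₂
  obtain ⟨i₁, p₁, hi₁, rfl⟩ := hm₁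
  obtain ⟨i₂, p₂, hi₂, rfl⟩ := hm₂
  have hret : ∀ i p, IsFirstReturn (IsHeavy (prefixCount w b) α n) i p →
      (p = p₁ ∧ prefixCount w b (i + p) - prefixCount w b i =
        prefixCount w b (i₁ + p₁) - prefixCount w b i₁) ∨
      (p = p₂ ∧ prefixCount w b (i + p) - prefixCount w b i =
        prefixCount w b (i₂ + p₂) - prefixCount w b i₂) := by
    intro i p hip
    have hmem : (factorAt w i p : Multiset A) ∈ abelianReturns w (factorAt w i₀ n) :=
      (mem_abelianReturns_iff hab h hi₀ _).2 ⟨i, p, hip, rfl⟩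
    rwa [hset, Set.mem_insert_iff, Set.mem_singleton_iff, coe_factorAt_eq_iff hab h,
      coe_factorAt_eq_iff hab h] at hmem
  -- two heavy windows cannot have a first difference
  have key : ∀ i j k, IsHeavy (prefixCount w b) α n i → k < n →
      (∀ m < k, w (i + m) = w (j + m)) → w (i + k) = a → w (j + k) = b → False := by
    intro i j k hi hk heq hik hjk
    have h1 := ((factorAt_perm_iff hab h).1 (List.Perm.of_eq (factorAt_eq_iff.2 heq))).2
    have h2 : prefixCount w b (i + k + 1) = _ := prefixCount_succ_of_ne (hik.trans_ne hab)
    have h3 : prefixCount w b (j + k + 1) = _ := prefixCount_succ_of_eq hjk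
    have h4 : prefixCount w b (i + (k + 1)) - prefixCount w b i =
        prefixCount w b (j + (k + 1)) - prefixCount w b j - 1 := by
      rw [← Nat.add_assoc, ← Nat.add_assoc]
      omega
    have h5 := deviation_add (prefixCount w b) α i (k + 1)
    have h6 := deviation_add (prefixCount w b) α j (k + 1)
    rw [h4] at h5
    have h7 := hc.deviation_sub_ne_zero (i := i) (p := k + 1) (by omega)
    -- The displacement from `i` exceeds that from `j` by 1, and the latter is at least `-1`; being
    -- nonzero, the former is positive. Moving up from a heavy position stays heavy.
    have h8 : deviation (prefixCount w b) α i < deviation (prefixCount w b) α (i + (k + 1)) := by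
      refine sub_pos.1 (lt_of_le_of_ne ?_ h7.symm)
      rw [Int.cast_sub, Int.cast_one] at h5
      linarith [hc.lower (j + (k + 1)), hc.upper j]
    exact hc.not_two_returns hn hret (by omega) (by omega) hi
      (hc.isHeavy_of_lt hn ((hc.le_of_isHeavy hi).trans_lt h8)) h8
  refine ⟨isFactor_factorAt w i₀ n, ?_⟩
  rintro v ⟨j, hjv⟩ hv
  have hlen : v.length = n := hv.length_eq.trans (length_factorAt w i₀ n)
  rw [hlen] at hjv
  subst hjv
  have hj : IsHeavy (prefixCount w b) α n j := ((factorAt_perm_iff hab h).1 hv).2.trans hi₀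
  by_contra hne
  rw [factorAt_eq_iff] at hne
  push Not at hne
  obtain ⟨hk, hk'⟩ := Nat.find_spec hne
  have hlt : ∀ m < Nat.find hne, w (j + m) = w (i₀ + m) := fun m hm => by
    by_contra hcon
    exact Nat.find_min hne hm ⟨hm.trans hk, hcon⟩
  rcases h (j + Nat.find hne) with h1 | h1 <;> rcases h (i₀ + Nat.find hne) with h2 | h2
  · exact hk' (h1.trans h2.symm)
  · exact key j i₀ _ hj hk hlt h1 h2
  · exact key i₀ j _ hi₀ hk (fun m hm => (hlt m hm).symm) h2 h1
  · exact hk' (h1.trans h2.symm)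

/-- If two windows differ by one occurrence of `b`, then the larger one is heavy. -/
theorem isHeavy_of_eq_add_one (hc : IsCutting (prefixCount w b) α lo) (hn : 0 < n) {p q : ℕ}
    (hpq : prefixCount w b (p + n) - prefixCount w b p =
      prefixCount w b (q + n) - prefixCount w b q + 1) :
    IsHeavy (prefixCount w b) α n p := by
  have h1 := hc.sub_eq_or hn p
  have h2 := hc.sub_eq_or hn q
  unfold IsHeavy
  omega

/-- Appending or prepending `b` to a special factor of length `N + 1` gives one more `b` than using
`a`, hence a heavy window, which singularity identifies with `u`. -/
theorem exists_bispecial_of_isSingular (hw : IsSturmian w)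
    (hc : IsCutting (prefixCount w b) α lo) (hab : a ≠ b) (h : ∀ k, w k = a ∨ w k = b)
    {N : ℕ} (hi₀ : IsHeavy (prefixCount w b) α (N + 2) i₀)
    (hsing : IsSingular w (factorAt w i₀ (N + 2))) :
    ∃ B : List A, IsBispecial w B ∧ factorAt w i₀ (N + 2) = [b] ++ B ++ [b] := by
  obtain ⟨p, q, hpq, hp, hq⟩ : ∃ p q, factorAt w p (N + 1) = factorAt w q (N + 1) ∧
      w (p + (N + 1)) = b ∧ w (q + (N + 1)) = a := by
    obtain ⟨p, q, hpq, hne⟩ := hw.exists_rightSpecial (N + 1)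
    rcases h (p + (N + 1)) with h1 | h1 <;> rcases h (q + (N + 1)) with h2 | h2
    · exact absurd (h1.trans h2.symm) hne
    · exact ⟨q, p, hpq.symm, h2, h1⟩
    · exact ⟨p, q, hpq, h1, h2⟩
    · exact absurd (h1.trans h2.symm) hne
  obtain ⟨r, s, hrs, hr, hs⟩ : ∃ r s, factorAt w (r + 1) (N + 1) = factorAt w (s + 1) (N + 1) ∧
      w r = b ∧ w s = a := by
    obtain ⟨r, s, hrs, hne⟩ := hw.exists_leftSpecial (N + 1)
    rcases h r with h1 | h1 <;> rcases h s with h2 | h2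
    · exact absurd (h1.trans h2.symm) hne
    · exact ⟨s, r, hrs.symm, h2, h1⟩
    · exact ⟨r, s, hrs, h1, h2⟩
    · exact absurd (h1.trans h2.symm) hne
  have hpu : factorAt w p (N + 2) = factorAt w i₀ (N + 2) := by
    refine factorAt_eq_of_isSingular hab h hi₀ hsing
      (isHeavy_of_eq_add_one hc (by omega) (q := q) ?_)
    have h1 := ((factorAt_perm_iff hab h).1 (List.Perm.of_eq hpq)).2
    have h2 : prefixCount w b (p + (N + 1) + 1) = _ := prefixCount_succ_of_eq hp
    have h3 : prefixCount w b (q + (N + 1) + 1) = _ := prefixCount_succ_of_ne (hq.trans_ne hab)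
    rw [show p + (N + 2) = p + (N + 1) + 1 by omega, show q + (N + 2) = q + (N + 1) + 1 by omega]
    omega
  have hru : factorAt w r (N + 2) = factorAt w i₀ (N + 2) := by
    refine factorAt_eq_of_isSingular hab h hi₀ hsing
      (isHeavy_of_eq_add_one hc (by omega) (q := s) ?_)
    have h1 := ((factorAt_perm_iff hab h).1 (List.Perm.of_eq hrs)).2
    have h2 : prefixCount w b (r + 1) = _ := prefixCount_succ_of_eq hr
    have h3 : prefixCount w b (s + 1) = _ := prefixCount_succ_of_ne (hs.trans_ne hab)
    rw [show r + (N + 2) = r + 1 + (N + 1) by omega, show s + (N + 2) = s + 1 + (N + 1) by omega]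
    omega
  have hpr := hpu.trans hru.symm
  have hlast : w (r + 1 + N) = b := by
    have := factorAt_eq_iff.1 hpr (N + 1) (by omega)
    rw [show r + 1 + N = r + (N + 1) by omega, ← this, hp]
  have hBp : factorAt w (p + 1) N = factorAt w (r + 1) N := by
    rw [factorAt_eq_iff] at hpr ⊢
    intro k hk
    have := hpr (k + 1) (by omega)
    rwa [show p + (k + 1) = p + 1 + k by omega, show r + (k + 1) = r + 1 + k by omega] at this
  have hBq : factorAt w (q + 1) N = factorAt w (r + 1) N := by
    rw [← hBp]
    rw [factorAt_succ', factorAt_succ'] at hpq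
    exact (List.cons.inj hpq).2.symm
  have hBs : factorAt w (s + 1) N = factorAt w (r + 1) N := by
    rw [factorAt_succ, factorAt_succ] at hrs
    exact (List.append_inj' hrs rfl).1.symm
  refine ⟨factorAt w (r + 1) N, ⟨⟨a, b, hab, ?_, ?_⟩, ⟨a, b, hab, ?_, ?_⟩⟩, ?_⟩
  · rw [← hBq, ← hq, show q + (N + 1) = q + 1 + N by omega, ← factorAt_succ]
    exact isFactor_factorAt _ _ _
  · rw [← hlast, ← factorAt_succ]
    exact isFactor_factorAt _ _ _
  · rw [← hBs, ← hs, ← factorAt_succ']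
    exact isFactor_factorAt _ _ _
  · rw [← hr, ← factorAt_succ']
    exact isFactor_factorAt _ _ _
  · rw [← hru, factorAt_succ', factorAt_succ, hr, hlast]
    simp

end Heavy

theorem isSingular_nil (w : ℕ → A) : IsSingular w [] :=
  ⟨⟨0, by simp [factorAt]⟩, fun _ _ h => List.Perm.eq_nil h⟩

/-- The empty word is treated apart since heaviness is of use only for `n > 0`: it occurs
everywhere, so its returns are the two letters. -/
theorem IsSturmian.ncard_abelianReturns_nil (hw : IsSturmian w) :
    (abelianReturns w []).ncard = 2 := by
  obtain ⟨a, b, hab, h⟩ := hw.exists_letters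
  obtain ⟨i, j, -, hij⟩ := hw.exists_rightSpecial 0
  have hocc : ∀ k, AbelianOccursAt w [] k := fun k => by
    simp [AbelianOccursAt, AbelianEquiv, factorAt]
  have hone : ∀ k, (factorAt w k 1 : Multiset A) = {w k} := fun k => by simp [factorAt]
  rw [Set.ncard_eq_two]
  refine ⟨{w i}, {w j}, fun heq => hij (Multiset.singleton_inj.1 heq), ?_⟩
  ext m
  simp only [abelianReturns, hocc, true_and, not_true_eq_false, Set.mem_ofPred_eq,
    Set.mem_insert_iff, Set.mem_singleton_iff]
  constructor
  · rintro ⟨k, l, hkl, hfirst, rfl⟩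
    have hl : l = k + 1 := by
      by_contra hne
      exact hfirst (k + 1) (by omega) (by omega)
    rw [hl, Nat.add_sub_cancel_left, hone, Multiset.singleton_inj, Multiset.singleton_inj]
    simp only [add_zero] at hij
    rcases h k with h1 | h1 <;> rcases h i with h2 | h2 <;> rcases h j with h3 | h3 <;>
      simp_all
  · rintro (rfl | rfl)
    · exact ⟨i, i + 1, by omega, fun k _ _ => by omega, by rw [Nat.add_sub_cancel_left, hone]⟩
    · exact ⟨j, j + 1, by omega, fun k _ _ => by omega, by rw [Nat.add_sub_cancel_left, hone]⟩

end Main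

theorem mainTheorem3 {A : Type*} [Finite A] (w : ℕ → A) (hw : IsSturmian w)
    (u : List A) (hu : IsFactor w u) :
    ((abelianReturns w u).ncard = 2 ↔ IsSingular w u) ∧
      (IsSingular w u → 2 ≤ u.length →
        ∃ (a : A) (B : List A), IsBispecial w B ∧ u = [a] ++ B ++ [a]) := by
  obtain ⟨i₀, hi₀⟩ := hu
  obtain ⟨n, hn⟩ : ∃ n, n = u.length := ⟨_, rfl⟩
  rw [← hn] at hi₀ ⊢
  rcases Nat.eq_zero_or_pos n with h0 | h0
  · obtain rfl : u = [] := List.length_eq_zero_iff.1 (hn.symm.trans h0)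
    exact ⟨iff_of_true hw.ncard_abelianReturns_nil (isSingular_nil w), fun _ h2 => by omega⟩
  obtain ⟨a, b, α, lo, hab, h, hc, hheavy⟩ := hw.exists_isHeavy i₀ h0
  subst hi₀
  refine ⟨⟨isSingular_of_ncard_abelianReturns hc hab h h0 hheavy,
    ncard_abelianReturns_of_isSingular hc hab h h0 hheavy⟩, fun hsing h2 => ?_⟩
  obtain ⟨N, rfl⟩ : ∃ N, n = N + 2 := ⟨n - 2, by omega⟩
  obtain ⟨B, hB⟩ := exists_bispecial_of_isSingular hw hc hab h hheavy hsing
  exact ⟨b, B, hB⟩
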